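/- Let $(M,g)$ be a globally hyperbolic Lorentzian manifold: a smooth (Hausdorff, second countable) connected, time-oriented manifold $M$ with a smooth metric $g$ of signature $(-,+,\dots,+)$ which is strongly causal and for which $J_+^M(p)\cap J_-^M(q)$ is compact for all $p,q\in M$. Let $\mathrm{dV}$ be the volume density of $g$. Let $E\to M$ be a smooth real or complex vector bundle of finite rank with dual bundle $E^*$; write $\mathbb K=\mathbb R$ or $\mathbb C$ accordingly, $C^\infty(M,E)$ for the smooth sections, and $\mathcal D(M,E)$ for the compactly supported smooth sections. Let $P:C^\infty(M,E)\to C^\infty(M,E)$ be a wave operator, i.e. a linear differential operator which in local coordinates of $M$ and local trivializations of $E$ has the form $$P=-\sum_{i,j}g^{ij}\frac{\partial^2}{\partial x^i\partial x^j}+\sum_jA_j\frac{\partial}{\partial x^j}+B$$ with smooth matrix-valued coefficients $A_j,B$. Let $P^*:C^\infty(M,E^*)\to C^\infty(M,E^*)$ be its formal adjoint, i.e. the linear differential operator with $\int_M\varphi\cdot(P\psi)\,\mathrm{dV}=\int_M(P^*\varphi)\cdot\psi\,\mathrm{dV}$ for all $\varphi\in\mathcal D(M,E^*)$ and $\psi\in\mathcal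 D(M,E)$, where $\cdot$ is the pointwise dual pairing. A $\mathbb K$-linear map $G_\pm:\mathcal D(M,E)\to C^\infty(M,E)$ is an advanced ($+$), respectively retarded ($-$), Green's operator for $P$ if $PG_\pm\psi=\psi$, $G_\pm P\psi=\psi$ and $\operatorname{supp}(G_\pm\psi)\subset J_\pm^M(\operatorname{supp}\psi)$ for all $\psi\in\mathcal D(M,E)$; Green's operators for $P^*$ are defined in the same way. Let $G_\pm$ be the advanced and retarded Green's operators for $P$ and $G^*_\pm$ those for $P^*$. Then $$\int_M(G^*_\pm\varphi)\cdot\psi\,\mathrm{dV}=\int_M\varphi\cdot(G_\mp\psi)\,\mathrm{dV}$$ for all $\varphi\in\mathcal D(M,E^*)$ and $\psi\in\mathcal D(M,E)$. -/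

import Mathlib

open Bundle MeasureTheory
open scoped Manifold ContDiff Topology

noncomputable section

namespace LorentzGreen

/-! ### Lorentzian metrics, time orientations and causality -/

section Lorentz

variable (n : ℕ) (M : Type*) [TopologicalSpace M] [ChartedSpace (EuclideanSpace ℝ (Fin n)) M]
  [IsManifold (𝓡 n) ∞ M]

/-- A smooth Lorentzian metric on the `n`-dimensional manifold `M`: a smooth field of symmetric
bilinear forms of signature `(-,+,…,+)` on the tangent spaces. -/
structure LorentzianMetric where
  /-- the bilinear form on each tangent space -/
  inner (x : M) : TangentSpace (𝓡 n) x →L[ℝ] TangentSpace (𝓡 n) x →L[ℝ] ℝ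
  symm (x : M) (v w : TangentSpace (𝓡 n) x) : inner x v w = inner x w v
  signature (x : M) : ∃ (b : Module.Basis (Fin n) ℝ (TangentSpace (𝓡 n) x)) (i₀ : Fin n),
    ∀ i j, inner x (b i) (b j) = if i = j then (if i = i₀ then -1 else 1) else 0
  contMDiff : ContMDiff (𝓡 n)
    ((𝓡 n).prod 𝓘(ℝ, EuclideanSpace ℝ (Fin n) →L[ℝ] EuclideanSpace ℝ (Fin n) →L[ℝ] ℝ)) ∞
    (fun x ↦ TotalSpace.mk'
      (EuclideanSpace ℝ (Fin n) →L[ℝ] EuclideanSpace ℝ (Fin n) →L[ℝ] ℝ) x (inner x))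

variable {n M}

/-- A time orientation of `(M, g)`, given by a continuous timelike vector field. At each point the
future directed timelike vectors are those in the connected component of this field. -/
structure TimeOrientation (g : LorentzianMetric n M) where
  /-- the timelike vector field -/
  field (x : M) : TangentSpace (𝓡 n) x
  timelike (x : M) : g.inner x (field x) (field x) < 0
  continuous : Continuous (fun x ↦ (⟨x, field x⟩ : TangentBundle (𝓡 n) M))

variable {g : LorentzianMetric n M}

/-- A tangent vector is causal if it is timelike, or lightlike and nonzero. -/
def IsCausal (g : LorentzianMetric n M) (x : M) (v : TangentSpace (𝓡 n) x) : Prop :=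
  v ≠ 0 ∧ g.inner x v v ≤ 0

/-- Future directed causal vectors: those in the half cone that contains the orienting field. -/
def IsFutureCausal (τ : TimeOrientation g) (x : M) (v : TangentSpace (𝓡 n) x) : Prop :=
  IsCausal g x v ∧ g.inner x (τ.field x) v < 0

/-- Past directed causal vectors. -/
def IsPastCausal (τ : TimeOrientation g) (x : M) (v : TangentSpace (𝓡 n) x) : Prop :=
  IsCausal g x v ∧ 0 < g.inner x (τ.field x) v

/-- `γ` restricted to `[a, b]` is a piecewise `C^1` curve all of whose tangent vectors satisfy `C`:
away from a finite set `D` of break points the interval splits into closed pieces, on each of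
which `γ` is `C^1` up to the end points, with (one-sided at the end points) tangent vectors
in `C`. As the pieces are closed, `γ` is continuous on `[a, b]`. -/
def IsPiecewiseC1Curve (C : (x : M) → TangentSpace (𝓡 n) x → Prop) (γ : ℝ → M) (a b : ℝ) : Prop :=
  a < b ∧ ∃ D : Set ℝ, D.Finite ∧ ∀ c d : ℝ, a ≤ c → c < d → d ≤ b → Disjoint (Set.Ioo c d) D →
    ContMDiffOn 𝓘(ℝ, ℝ) (𝓡 n) 1 γ (Set.Icc c d) ∧
    ∀ t ∈ Set.Icc c d, C (γ t) (mfderivWithin 𝓘(ℝ, ℝ) (𝓡 n) γ (Set.Icc c d) t (1 : ℝ))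

/-- The points of `A`, together with the points that are reached from `A` by piecewise `C^1` curves
with tangent vectors in `C`. -/
def reachable (C : (x : M) → TangentSpace (𝓡 n) x → Prop) (A : Set M) : Set M :=
  {q | ∃ p ∈ A, q = p ∨ ∃ (γ : ℝ → M) (a b : ℝ), IsPiecewiseC1Curve C γ a b ∧ γ a = p ∧ γ b = q}

/-- The causal future `J_+(A)`. -/
def causalFuture (τ : TimeOrientation g) (A : Set M) : Set M := reachable (IsFutureCausal τ) A

/-- The causal past `J_-(A)`. -/
def causalPast (τ : TimeOrientation g) (A : Set M) : Set M := reachable (IsPastCausal τ) A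

/-- Strong causality: there are no almost closed (future directed) causal curves. -/
def StronglyCausal (τ : TimeOrientation g) : Prop :=
  ∀ (p : M) (U : Set M), IsOpen U → p ∈ U → ∃ V ⊆ U, IsOpen V ∧ p ∈ V ∧
    ∀ (γ : ℝ → M) (a b : ℝ), IsPiecewiseC1Curve (IsFutureCausal τ) γ a b → γ a ∈ V → γ b ∈ V →
      γ '' Set.Icc a b ⊆ U

/-- Global hyperbolicity of the time oriented Lorentzian manifold `(M, g)`. -/
structure GloballyHyperbolic (τ : TimeOrientation g) : Prop where
  connected : ConnectedSpace M
  stronglyCausal : StronglyCausal τ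
  isCompact_diamond : ∀ p q : M, IsCompact (causalFuture τ {p} ∩ causalPast τ {q})

/-- The coordinate vector field `∂/∂x^i` of the chart `φ` at the point with coordinates `y`. -/
def coordVec (φ : OpenPartialHomeomorph M (EuclideanSpace ℝ (Fin n))) (y : EuclideanSpace ℝ (Fin n))
    (i : Fin n) : TangentSpace (𝓡 n) (φ.symm y) :=
  mfderiv (𝓡 n) (𝓡 n) φ.symm y (EuclideanSpace.single i (1 : ℝ) : EuclideanSpace ℝ (Fin n))

/-- The matrix `g_{ij} = g(∂/∂x^i, ∂/∂x^j)` in the chart `φ` at the point with coordinates `y`. -/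
def metricMatrix (g : LorentzianMetric n M)
    (φ : OpenPartialHomeomorph M (EuclideanSpace ℝ (Fin n))) (y : EuclideanSpace ℝ (Fin n)) :
    Matrix (Fin n) (Fin n) ℝ :=
  Matrix.of fun i j ↦ g.inner (φ.symm y) (coordVec φ y i) (coordVec φ y j)

variable [MeasurableSpace M]

/-- The measure `√|det g_{ij}| dx^1 ⋯ dx^n` on the domain of the chart `φ`, extended by zero. -/
def chartVolume (g : LorentzianMetric n M)
    (φ : OpenPartialHomeomorph M (EuclideanSpace ℝ (Fin n))) : Measure M :=
  ((volume.restrict φ.target).withDensity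
    (fun y ↦ ENNReal.ofReal (Real.sqrt |(metricMatrix g φ y).det|))).map φ.symm

/-- The volume measure `dV` of `(M, g)`. The measures `chartVolume g φ` agree on the overlaps of
chart domains, and `dV` is the measure obtained by gluing them, that is, the least measure that
dominates all of them. -/
def volumeMeasure (g : LorentzianMetric n M) : Measure M :=
  ⨆ φ ∈ atlas (EuclideanSpace ℝ (Fin n)) M, chartVolume g φ

end Lorentz

/-! ### Vector bundles and their sections -/

section Bundles

variable (n : ℕ) {M : Type*} [TopologicalSpace M] [ChartedSpace (EuclideanSpace ℝ (Fin n)) M]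
  (𝕜 : Type*) [RCLike 𝕜]
  (F : Type*) [NormedAddCommGroup F] [NormedSpace ℝ F] [NormedSpace 𝕜 F] [IsScalarTower ℝ 𝕜 F]
  (E : M → Type*) [TopologicalSpace (TotalSpace F E)] [∀ x, TopologicalSpace (E x)]
  [∀ x, AddCommGroup (E x)] [∀ x, Module 𝕜 (E x)] [FiberBundle F E] [VectorBundle 𝕜 F E]

/-- The `𝕜`-vector bundle `E` over the (real) manifold `M` is smooth: its transition functions are
smooth. (`ContMDiffVectorBundle` is this condition in the case that `𝕜` is also the base field of
the manifold; here `𝕜` may be `ℂ`.) -/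
class IsSmoothVectorBundle : Prop where
  contMDiffOn_coordChangeL : ∀ (e e' : Trivialization F (π F E))
    [MemTrivializationAtlas e] [MemTrivializationAtlas e'],
    ContMDiffOn (𝓡 n) 𝓘(ℝ, F →L[𝕜] F) ∞ (fun x : M ↦ (e.coordChangeL 𝕜 e' x : F →L[𝕜] F))
      (e.baseSet ∩ e'.baseSet)

/-- The space `C^∞(M, E)` of smooth sections. -/
def smoothSections : Submodule 𝕜 ((x : M) → E x) where
  carrier := {s | ContMDiff (𝓡 n) ((𝓡 n).prod 𝓘(ℝ, F)) ∞ (fun x ↦ TotalSpace.mk' F x (s x))}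
  zero_mem' := by
    intro x₀
    rw [contMDiffAt_section]
    refine (contMDiffAt_const (c := (0 : F))).congr_of_eventuallyEq ?_
    filter_upwards [(trivializationAt F E x₀).open_baseSet.mem_nhds
      (mem_baseSet_trivializationAt F E x₀)] with x hx
    exact ((trivializationAt F E x₀).linear 𝕜 hx).map_zero
  add_mem' := by
    intro s t hs ht x₀
    have h1 := (contMDiffAt_section x₀).1 (hs x₀)
    have h2 := (contMDiffAt_section x₀).1 (ht x₀)
    rw [contMDiffAt_section]
    refine (h1.add h2).congr_of_eventuallyEq ?_
    filter_upwards [(trivializationAt F E x₀).open_baseSet.mem_nhds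
      (mem_baseSet_trivializationAt F E x₀)] with x hx
    exact ((trivializationAt F E x₀).linear 𝕜 hx).map_add _ _
  smul_mem' := by
    intro c s hs x₀
    have h1 := (contMDiffAt_section x₀).1 (hs x₀)
    rw [contMDiffAt_section]
    have h2 : ContMDiff 𝓘(ℝ, F) 𝓘(ℝ, F) ∞ (fun v : F ↦ c • v) :=
      (contDiff_const_smul c).contMDiff
    refine (h2.contMDiffAt.comp x₀ h1).congr_of_eventuallyEq ?_
    filter_upwards [(trivializationAt F E x₀).open_baseSet.mem_nhds
      (mem_baseSet_trivializationAt F E x₀)] with x hx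
    exact ((trivializationAt F E x₀).linear 𝕜 hx).map_smul _ _

variable {E} in
/-- The support of a section. -/
def sectionSupport (s : (x : M) → E x) : Set M := closure {x | s x ≠ 0}

/-- The space `𝒟(M, E)` of test sections: the smooth sections with compact support. -/
def testSections : Submodule 𝕜 (smoothSections n 𝕜 F E) where
  carrier := {s | IsCompact (sectionSupport s.1)}
  zero_mem' := by simp [sectionSupport]
  add_mem' := by
    intro s t hs ht
    refine (hs.union ht).of_isClosed_subset isClosed_closure ?_
    rw [sectionSupport, sectionSupport, sectionSupport, ← closure_union]
    refine closure_mono fun x hx ↦ ?_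
    by_contra h
    simp only [Set.mem_union, Set.mem_ofPred_eq, not_or, not_not] at h
    exact hx (by simp [h.1, h.2])
  smul_mem' := by
    intro c s hs
    refine IsCompact.of_isClosed_subset hs isClosed_closure (closure_mono fun x hx ↦ ?_)
    intro h
    exact hx (by simp [h])

/-- The fibres of the dual bundle `E^*`; the bundle has model fibre `F →L[𝕜] 𝕜`. -/
abbrev Dual (x : M) : Type _ := E x →L[𝕜] 𝕜

/-! ### Differential operators -/

variable {F E} in
/-- The section `s` in the coordinates of the chart `φ` and the local trivialization `e`. -/
def localRep (φ : OpenPartialHomeomorph M (EuclideanSpace ℝ (Fin n)))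
    (e : Trivialization F (π F E)) (s : (x : M) → E x) (y : EuclideanSpace ℝ (Fin n)) : F :=
  (e (TotalSpace.mk' F (φ.symm y) (s (φ.symm y)))).2

variable {n F} in
/-- The iterated partial derivative `∂^j f / ∂x^{a 1} ⋯ ∂x^{a j}` at `y`. -/
def partialDeriv (f : EuclideanSpace ℝ (Fin n) → F) (j : ℕ) (a : Fin j → Fin n)
    (y : EuclideanSpace ℝ (Fin n)) : F :=
  iteratedFDeriv ℝ j f y (fun l ↦ (EuclideanSpace.single (a l) (1 : ℝ)))

variable [IsManifold (𝓡 n) ∞ M]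

/-- Linear differential operators `P : C^∞(M, E) → C^∞(M, E)`: in all local coordinates and local
trivializations, `P` is a combination of partial derivatives, of order bounded by some `k`, with
smooth matrix-valued coefficients. -/
structure DiffOp extends smoothSections n 𝕜 F E →ₗ[𝕜] smoothSections n 𝕜 F E where
  exists_order : ∃ k : ℕ, ∀ φ ∈ IsManifold.maximalAtlas (𝓡 n) ∞ M,
    ∀ (e : Trivialization F (π F E)) [MemTrivializationAtlas e],
    ∃ A : (j : ℕ) → (Fin j → Fin n) → M → F →L[𝕜] F,
      (∀ j a, ContMDiffOn (𝓡 n) 𝓘(ℝ, F →L[𝕜] F) ∞ (A j a) (φ.source ∩ e.baseSet)) ∧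
      ∀ s : smoothSections n 𝕜 F E, ∀ x ∈ φ.source ∩ e.baseSet,
        (e (TotalSpace.mk' F x ((toFun s).1 x))).2 =
          ∑ j ∈ Finset.range (k + 1), ∑ a : Fin j → Fin n,
            A j a x (partialDeriv (localRep n φ e s.1) j a (φ x))

namespace DiffOp

variable {n 𝕜 F E}

/-- Differential operators do not increase supports. -/
theorem sectionSupport_subset (P : DiffOp n 𝕜 F E) (s : smoothSections n 𝕜 F E) :
    sectionSupport (P.toLinearMap s).1 ⊆ sectionSupport s.1 := by
  obtain ⟨k, hk⟩ := P.exists_order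
  refine closure_minimal (fun x hx ↦ ?_) isClosed_closure
  by_contra hxs
  apply hx
  have hs : ∀ᶠ z in 𝓝 x, s.1 z = 0 := by
    filter_upwards [isClosed_closure.isOpen_compl.mem_nhds hxs] with z hz
    by_contra h
    exact hz (subset_closure h)
  have hxe := mem_baseSet_trivializationAt F E x
  have hxφ := mem_chart_source (EuclideanSpace ℝ (Fin n)) x
  obtain ⟨A, -, hA⟩ := hk (chartAt (EuclideanSpace ℝ (Fin n)) x)
    (IsManifold.chart_mem_maximalAtlas x) (trivializationAt F E x)
  have h := hA s x ⟨hxφ, hxe⟩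
  have hrep : localRep n (chartAt (EuclideanSpace ℝ (Fin n)) x) (trivializationAt F E x) s.1
      =ᶠ[𝓝 (chartAt (EuclideanSpace ℝ (Fin n)) x x)] fun _ ↦ 0 := by
    have ht := (chartAt (EuclideanSpace ℝ (Fin n)) x).tendsto_symm hxφ
    filter_upwards [ht.eventually hs,
      ht.eventually ((trivializationAt F E x).open_baseSet.mem_nhds hxe)] with y h1 h2
    rw [localRep, h1]
    exact ((trivializationAt F E x).linear 𝕜 h2).map_zero
  have hD : ∀ (j : ℕ) (a : Fin j → Fin n), partialDeriv
      (localRep n (chartAt (EuclideanSpace ℝ (Fin n)) x) (trivializationAt F E x) s.1) j a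
      (chartAt (EuclideanSpace ℝ (Fin n)) x x) = 0 := by
    intro j a
    rw [partialDeriv, (hrep.iteratedFDeriv ℝ j).eq_of_nhds]
    simp
  simp only [hD, map_zero, Finset.sum_const_zero] at h
  have hl := (trivializationAt F E x).linear 𝕜 hxe
  exact ((trivializationAt F E x).continuousLinearEquivAt 𝕜 x hxe).injective
    (h.trans hl.map_zero.symm)

/-- The restriction of a differential operator to test sections. -/
def onTest (P : DiffOp n 𝕜 F E) : testSections n 𝕜 F E →ₗ[𝕜] testSections n 𝕜 F E :=
  P.toLinearMap.restrict fun s hs ↦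
    IsCompact.of_isClosed_subset hs isClosed_closure (P.sectionSupport_subset s)

end DiffOp

variable {n 𝕜 F E}

/-- Wave operators (normally hyperbolic operators): in all local coordinates and local
trivializations, `P = -∑ g^{ij} ∂_i ∂_j + ∑ A_j ∂_j + B` with smooth matrix-valued `A_j`, `B`. -/
def IsWaveOperator (g : LorentzianMetric n M) (P : DiffOp n 𝕜 F E) : Prop :=
  ∀ φ ∈ IsManifold.maximalAtlas (𝓡 n) ∞ M,
  ∀ (e : Trivialization F (π F E)) [MemTrivializationAtlas e],
  ∃ (A : Fin n → M → F →L[𝕜] F) (B : M → F →L[𝕜] F),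
    (∀ j, ContMDiffOn (𝓡 n) 𝓘(ℝ, F →L[𝕜] F) ∞ (A j) (φ.source ∩ e.baseSet)) ∧
    ContMDiffOn (𝓡 n) 𝓘(ℝ, F →L[𝕜] F) ∞ B (φ.source ∩ e.baseSet) ∧
    ∀ s : smoothSections n 𝕜 F E, ∀ x ∈ φ.source ∩ e.baseSet,
      (e (TotalSpace.mk' F x ((P.toLinearMap s).1 x))).2 =
        -(∑ i, ∑ j, (metricMatrix g φ (φ x))⁻¹ i j •
            partialDeriv (localRep n φ e s.1) 2 ![i, j] (φ x))
          + ∑ j, A j x (partialDeriv (localRep n φ e s.1) 1 ![j] (φ x))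
          + B x (localRep n φ e s.1 (φ x))

/-- `G : 𝒟(M, E) → C^∞(M, E)` is a Green's operator for `P` with supports controlled by `J`. -/
structure IsGreenOperator (J : Set M → Set M) (P : DiffOp n 𝕜 F E)
    (G : testSections n 𝕜 F E →ₗ[𝕜] smoothSections n 𝕜 F E) : Prop where
  right_inv (φ : testSections n 𝕜 F E) : P.toLinearMap (G φ) = φ.1
  left_inv (φ : testSections n 𝕜 F E) : G (P.onTest φ) = φ.1
  support_subset (φ : testSections n 𝕜 F E) :
    sectionSupport (G φ).1 ⊆ J (sectionSupport φ.1.1)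

/-- Advanced Green's operators: `supp (G φ) ⊆ J_+(supp φ)`. -/
def IsAdvancedGreenOperator {g : LorentzianMetric n M} (τ : TimeOrientation g)
    (P : DiffOp n 𝕜 F E) (G : testSections n 𝕜 F E →ₗ[𝕜] smoothSections n 𝕜 F E) : Prop :=
  IsGreenOperator (causalFuture τ) P G

/-- Retarded Green's operators: `supp (G φ) ⊆ J_-(supp φ)`. -/
def IsRetardedGreenOperator {g : LorentzianMetric n M} (τ : TimeOrientation g)
    (P : DiffOp n 𝕜 F E) (G : testSections n 𝕜 F E →ₗ[𝕜] smoothSections n 𝕜 F E) : Prop :=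
  IsGreenOperator (causalPast τ) P G

variable [MeasurableSpace M] [∀ x, IsTopologicalAddGroup (E x)] [∀ x, ContinuousSMul 𝕜 (E x)]

/-- `Q = P^*` is the formal adjoint of `P`: the differential operator on sections of the dual
bundle with `∫ φ(P ψ) dV = ∫ (Q φ)(ψ) dV` for all test sections. -/
def IsFormalAdjoint (g : LorentzianMetric n M) (P : DiffOp n 𝕜 F E)
    (Q : DiffOp n 𝕜 (F →L[𝕜] 𝕜) (Dual 𝕜 E)) : Prop :=
  ∀ (ψ : testSections n 𝕜 F E) (φ : testSections n 𝕜 (F →L[𝕜] 𝕜) (Dual 𝕜 E)),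
    ∫ x, φ.1.1 x ((P.toLinearMap ψ.1).1 x) ∂(volumeMeasure g) =
      ∫ x, (Q.toLinearMap φ.1).1 x (ψ.1.1 x) ∂(volumeMeasure g)

end Bundles
end LorentzGreen
end

/-! Let G' be a Green's operator for P^* and G one for P with the opposite time direction. Formally
∫ (G'φ)·ψ = ∫ (G'φ)·(P Gψ) = ∫ (P^*G'φ)·(Gψ) = ∫ φ·(Gψ). Only the middle equality needs work: the
adjoint identity is given for test sections, and neither G'φ nor Gψ need have compact support. Their
supports meet only inside a set J_+(A) ∩ J_-(B) with A, B compact, which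
`GloballyHyperbolic.exists_isCompact` places in a compact K. Multiplying both sections by a cutoff
equal to 1 near K changes neither integrand at any point and produces test sections
(`IsFormalAdjoint.integral_eq`).

Global hyperbolicity only concerns single points. To reach compact sets, note that each point is
interior to J_+(p) for some p slightly in its past (`exists_reachable_mem_nhds`). Finitely many such
futures cover A, and by transitivity they contain J_+(A); likewise for J_-(B). So K is a finite
union of diamonds. Relative compactness is enough, so no closedness of J_+(A) or J_-(B) is needed.
-/

namespace LorentzGreen

/-! ### Concatenation of curves and transitivity of reachability. -/

section Causality

variable {n : ℕ} {M : Type*} [TopologicalSpace M] [ChartedSpace (EuclideanSpace ℝ (Fin n)) M]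

/-- `γ` is `C^1` on `[c, d]` with tangent vectors in `C`. -/
def IsC1Piece (C : (x : M) → TangentSpace (𝓡 n) x → Prop) (γ : ℝ → M) (c d : ℝ) : Prop :=
  ContMDiffOn 𝓘(ℝ, ℝ) (𝓡 n) 1 γ (Set.Icc c d) ∧
    ∀ t ∈ Set.Icc c d, C (γ t) (mfderivWithin 𝓘(ℝ, ℝ) (𝓡 n) γ (Set.Icc c d) t (1 : ℝ))

/-- All tangent spaces are definitionally the model space, so vectors over different base points can
be compared there. -/
theorem transport_tangent (C : (x : M) → TangentSpace (𝓡 n) x → Prop) {x y : M} (h : x = y)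
    {v w : EuclideanSpace ℝ (Fin n)} (hvw : v = w) (hC : C x v) : C y w := by
  subst h hvw
  exact hC

theorem uniqueMDiffWithinAt_Icc {c d t : ℝ} (hcd : c < d) (ht : t ∈ Set.Icc c d) :
    UniqueMDiffWithinAt 𝓘(ℝ, ℝ) (Set.Icc c d) t :=
  uniqueMDiffWithinAt_iff_uniqueDiffWithinAt.2 (uniqueDiffOn_Icc hcd t ht)

theorem IsC1Piece.congr_translate {C : (x : M) → TangentSpace (𝓡 n) x → Prop} {γ γ' : ℝ → M}
    {c d k : ℝ} (h : IsC1Piece C γ (c - k) (d - k)) (hcd : c < d)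
    (hγ : ∀ t ∈ Set.Icc c d, γ' t = γ (t - k)) : IsC1Piece C γ' c d := by
  have hmaps : Set.MapsTo (fun t : ℝ ↦ t - k) (Set.Icc c d) (Set.Icc (c - k) (d - k)) :=
    fun t ht ↦ ⟨sub_le_sub_right ht.1 k, sub_le_sub_right ht.2 k⟩
  have hsub : ContDiff ℝ 1 (fun t : ℝ ↦ t - k) := by fun_prop
  refine ⟨(h.1.comp hsub.contMDiff.contMDiffOn hmaps).congr hγ, fun t ht ↦ ?_⟩
  have h1 := ((h.1.mdifferentiableOn one_ne_zero) (t - k) (hmaps ht)).hasMFDerivWithinAt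
  have h2 : HasMFDerivWithinAt 𝓘(ℝ, ℝ) 𝓘(ℝ, ℝ) (fun t : ℝ ↦ t - k) (Set.Icc c d) t
      (ContinuousLinearMap.id ℝ ℝ) :=
    ((hasFDerivAt_id t).sub_const k).hasFDerivWithinAt.hasMFDerivWithinAt
  have h3 := (HasMFDerivWithinAt.comp t h1 h2 hmaps.subset_preimage).congr_mono hγ (hγ t ht) le_rfl
  refine transport_tangent C (hγ t ht).symm ?_ (h.2 (t - k) (hmaps ht))
  rw [h3.mfderivWithin (uniqueMDiffWithinAt_Icc hcd ht)]
  rfl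

/-- The junction `b` becomes a break point, so velocities need not match there. A piece that avoids
it lies on one side, where the curve is `γ₁` or a time translate of `γ₂`. -/
theorem IsPiecewiseC1Curve.concat {C : (x : M) → TangentSpace (𝓡 n) x → Prop} {γ₁ γ₂ : ℝ → M}
    {a b a' b' : ℝ} (h₁ : IsPiecewiseC1Curve C γ₁ a b) (h₂ : IsPiecewiseC1Curve C γ₂ a' b')
    (h : γ₁ b = γ₂ a') :
    IsPiecewiseC1Curve C (fun t ↦ if t ≤ b then γ₁ t else γ₂ (t - (b - a')))
      a (b' + (b - a')) := by
  obtain ⟨hab, D₁, hD₁, H₁⟩ := h₁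
  obtain ⟨hab', D₂, hD₂, H₂⟩ := h₂
  refine ⟨by linarith, insert b (D₁ ∪ (fun t ↦ t + (b - a')) '' D₂),
    (hD₁.union (hD₂.image _)).insert b, fun c d hac hcd hdb hdisj ↦ ?_⟩
  rw [Set.disjoint_left] at hdisj
  have hb : ¬ (c < b ∧ b < d) := fun hb ↦ hdisj hb (Set.mem_insert _ _)
  rcases le_or_gt d b with hd | hd
  · have := H₁ c d hac hcd hd
      (Set.disjoint_left.2 fun t ht ht' ↦ hdisj ht (.inr (.inl ht')))
    refine IsC1Piece.congr_translate (k := 0) (γ := γ₁) (by simpa [IsC1Piece] using this) hcd fun t ht ↦ ?_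
    simp [ht.2.trans hd]
  · have hc : b ≤ c := not_lt.1 fun hc ↦ hb ⟨hc, hd⟩
    have := H₂ (c - (b - a')) (d - (b - a')) (by linarith) (by linarith) (by linarith)
      (Set.disjoint_left.2 fun t ht ht' ↦ hdisj (a := t + (b - a'))
        ⟨by linarith [ht.1], by linarith [ht.2]⟩ (.inr (.inr ⟨t, ht', rfl⟩)))
    refine IsC1Piece.congr_translate (k := b - a') this hcd fun t ht ↦ ?_
    -- At `t = b` the definition selects `γ₁`, which agrees with `γ₂` there by `h`.
    rcases (hc.trans ht.1).eq_or_lt with rfl | hlt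
    · simp [h]
    · simp [hlt.not_ge]

theorem reachable_reachable (C : (x : M) → TangentSpace (𝓡 n) x → Prop) (A : Set M) :
    reachable C (reachable C A) ⊆ reachable C A := by
  rintro q ⟨p, ⟨r, hr, hp⟩, hq⟩
  refine ⟨r, hr, ?_⟩
  rcases hp with rfl | ⟨γ₁, a, b, h₁, rfl, rfl⟩
  · exact hq
  rcases hq with rfl | ⟨γ₂, a', b', h₂, h, rfl⟩
  · exact .inr ⟨γ₁, a, b, h₁, rfl, rfl⟩
  refine .inr ⟨_, _, _, h₁.concat h₂ h.symm, by simp [h₁.1.le], ?_⟩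
  have := h₂.1
  rw [if_neg (by linarith)]
  simp

theorem reachable_iUnion_subset (C : (x : M) → TangentSpace (𝓡 n) x → Prop) {A : Set M}
    {ι : Type*} {t : Finset ι} {p : ι → M} (h : A ⊆ ⋃ i ∈ t, reachable C {p i}) :
    reachable C A ⊆ ⋃ i ∈ t, reachable C {p i} := by
  rintro q ⟨r, hr, hq⟩
  obtain ⟨i, hi, hri⟩ := Set.mem_iUnion₂.1 (h hr)
  exact Set.mem_iUnion₂.2 ⟨i, hi, reachable_reachable C _ ⟨r, hri, hq⟩⟩

/-! ### Covering reachable sets of compact sets by those of finitely many points. -/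

variable [IsManifold (𝓡 n) ∞ M]

theorem continuousOn_tangentMap_chart_symm (a : M) :
    ContinuousOn (fun q : EuclideanSpace ℝ (Fin n) × EuclideanSpace ℝ (Fin n) ↦
      (⟨(chartAt (EuclideanSpace ℝ (Fin n)) a).symm q.1,
        mfderiv (𝓡 n) (𝓡 n) (chartAt (EuclideanSpace ℝ (Fin n)) a).symm q.1 q.2⟩ :
          TangentBundle (𝓡 n) M))
      ((chartAt (EuclideanSpace ℝ (Fin n)) a).target ×ˢ Set.univ) := by
  set φ := chartAt (EuclideanSpace ℝ (Fin n)) a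
  have h : ContMDiffOn (𝓡 n) (𝓡 n) ∞ φ.symm φ.target := contMDiffOn_chart_symm
  have h1 := h.continuousOn_tangentMapWithin (by simp) φ.open_target.uniqueMDiffOn
  have h2 : Continuous (fun q : EuclideanSpace ℝ (Fin n) × EuclideanSpace ℝ (Fin n) ↦
      (⟨q.1, q.2⟩ : TangentBundle (𝓡 n) (EuclideanSpace ℝ (Fin n)))) :=
    (tangentBundleModelSpaceHomeomorph (𝓡 n)).symm.continuous
  refine (h1.comp h2.continuousOn fun q hq ↦ hq.1).congr fun q hq ↦ ?_
  simp only [Function.comp, tangentMapWithin]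
  rw [mfderivWithin_of_isOpen φ.open_target hq.1]

/-- In a chart, start at a point slightly behind `a` along `T`. Straight segments from there to
points near `a` have velocity close to that of `T`, hence in the open set `U`. -/
theorem exists_reachable_mem_nhds {C : (x : M) → TangentSpace (𝓡 n) x → Prop}
    {U : Set (TangentBundle (𝓡 n) M)} (hU : IsOpen U) (hUC : ∀ v ∈ U, C v.1 v.2)
    (a : M) (T : TangentSpace (𝓡 n) a) (hT : (⟨a, T⟩ : TangentBundle (𝓡 n) M) ∈ U) :
    ∃ p : M, reachable C {p} ∈ 𝓝 a := by
  set φ := chartAt (EuclideanSpace ℝ (Fin n)) a with hφ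
  have haφ : a ∈ φ.source := mem_chart_source _ a
  have hφd : φ.MDifferentiable (𝓡 n) (𝓡 n) := mdifferentiable_chart a
  set W : EuclideanSpace ℝ (Fin n) := mfderiv (𝓡 n) (𝓡 n) φ a T with hW
  have hopen := (continuousOn_tangentMap_chart_symm (n := n) a).isOpen_inter_preimage
    (φ.open_target.prod isOpen_univ) hU
  -- The derivatives of `φ` and `φ.symm` are inverse, so `(φ a, W)` is sent back to `(a, T)`.
  have hmem : (φ a, W) ∈ (φ.target ×ˢ Set.univ) ∩ (fun q : EuclideanSpace ℝ (Fin n) ×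
      EuclideanSpace ℝ (Fin n) ↦ (⟨φ.symm q.1, mfderiv (𝓡 n) (𝓡 n) φ.symm q.1 q.2⟩ :
          TangentBundle (𝓡 n) M)) ⁻¹' U :=
    ⟨⟨φ.map_source haφ, trivial⟩, transport_tangent (fun x v ↦ (⟨x, v⟩ : TangentBundle (𝓡 n) M) ∈ U)
      (φ.left_inv haφ).symm (DFunLike.congr_fun (hφd.symm_comp_deriv haφ) T).symm hT⟩
  obtain ⟨r, hr, hball⟩ := Metric.isOpen_iff.1 hopen _ hmem
  -- The segments below stay within `ε * (2 * ‖W‖ + r)` of `φ a`; this must be less than `r`.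
  obtain ⟨ε, hε, hεr⟩ : ∃ ε : ℝ, 0 < ε ∧ ε * (2 * ‖W‖ + r) < r := by
    have : 0 < 2 * ‖W‖ + r + 1 := by positivity
    refine ⟨r / (2 * ‖W‖ + r + 1), by positivity, ?_⟩
    rw [div_mul_eq_mul_div, div_lt_iff₀ this]
    nlinarith
  refine ⟨φ.symm (φ a - ε • W), ?_⟩
  filter_upwards [(φ.continuousAt haφ).preimage_mem_nhds
    (Metric.ball_mem_nhds (φ a) (mul_pos hε hr)), φ.open_source.mem_nhds haφ] with x hx hxφ
  -- The constant velocity that leads from `φ a - ε • W` to `φ x` in time `ε`.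
  set w : EuclideanSpace ℝ (Fin n) := W + ε⁻¹ • (φ x - φ a) with hw
  have hwW : ‖w - W‖ < r := by
    rw [Set.mem_preimage, Metric.mem_ball, dist_eq_norm] at hx
    rw [hw, add_sub_cancel_left, norm_smul, norm_inv, Real.norm_of_nonneg hε.le]
    rwa [inv_mul_lt_iff₀ hε]
  have hin : ∀ t ∈ Set.Icc 0 ε, (φ a - ε • W + t • w, w) ∈ Metric.ball (φ a, W) r := by
    intro t ht
    rw [Metric.mem_ball, Prod.dist_eq, max_lt_iff, dist_eq_norm, dist_eq_norm]
    refine ⟨lt_of_le_of_lt ?_ hεr, hwW⟩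
    have h1 : ‖w‖ ≤ ‖W‖ + r := by linarith [norm_le_norm_add_norm_sub W w, norm_sub_rev w W]
    calc ‖φ a - ε • W + t • w - φ a‖ = ‖t • w - ε • W‖ := by congr 1; abel
      _ ≤ ‖t • w‖ + ‖ε • W‖ := norm_sub_le _ _
      _ = t * ‖w‖ + ε * ‖W‖ := by
        rw [norm_smul, norm_smul, Real.norm_of_nonneg ht.1, Real.norm_of_nonneg hε.le]
      _ ≤ ε * (‖W‖ + r) + ε * ‖W‖ := by gcongr; exact ht.2
      _ = ε * (2 * ‖W‖ + r) := by ring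
  have hline : ContDiff ℝ 1 (fun t : ℝ ↦ φ a - ε • W + t • w) := by fun_prop
  have hφs : ContMDiffOn (𝓡 n) (𝓡 n) 1 φ.symm φ.target :=
    (contMDiffOn_chart_symm (n := ∞)).of_le (by simp)
  refine ⟨_, rfl, .inr ⟨fun t ↦ φ.symm (φ a - ε • W + t • w), 0, ε, ⟨hε, ∅, Set.finite_empty,
    fun c d hc hcd hd _ ↦ ⟨?_, fun t ht ↦ ?_⟩⟩, by simp, ?_⟩⟩
  · exact hφs.comp hline.contMDiff.contMDiffOn
      fun t ht ↦ (hball (hin t ⟨hc.trans ht.1, ht.2.trans hd⟩)).1.1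
  · obtain ⟨⟨ht1, -⟩, ht2⟩ := hball (hin t ⟨hc.trans ht.1, ht.2.trans hd⟩)
    have h1 := ((hφd.symm.mdifferentiableAt ht1).hasMFDerivAt)
    have h2 : HasMFDerivWithinAt 𝓘(ℝ, ℝ) (𝓡 n) (fun t : ℝ ↦ φ a - ε • W + t • w) (Set.Icc c d) t
        ((ContinuousLinearMap.id ℝ ℝ).smulRight w) :=
      (((hasFDerivAt_id t).smul_const w).const_add _).hasFDerivWithinAt.hasMFDerivWithinAt
    have h3 := HasMFDerivAt.comp_hasMFDerivWithinAt (I' := 𝓡 n) t h1 h2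
    refine transport_tangent C rfl ?_ (hUC _ ht2)
    have h4 := h3.mfderivWithin (uniqueMDiffWithinAt_Icc hcd ht)
    refine (?_ : _ = _).trans (DFunLike.congr_fun h4 (1 : ℝ)).symm
    change _ = mfderiv (𝓡 n) (𝓡 n) φ.symm (φ a - ε • W + t • w) ((1 : ℝ) • w)
    rw [one_smul]
  · have : φ a - ε • W + ε • w = φ x := by
      rw [hw, smul_add, smul_inv_smul₀ hε.ne']
      abel
    simp only [this]
    exact φ.left_inv hxφ

theorem IsCompact.exists_finset_reachable {C : (x : M) → TangentSpace (𝓡 n) x → Prop}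
    {U : Set (TangentBundle (𝓡 n) M)} (hU : IsOpen U) (hUC : ∀ v ∈ U, C v.1 v.2)
    (hne : ∀ a : M, ∃ T : TangentSpace (𝓡 n) a, (⟨a, T⟩ : TangentBundle (𝓡 n) M) ∈ U)
    {A : Set M} (hA : IsCompact A) :
    ∃ t : Finset M, reachable C A ⊆ ⋃ p ∈ t, reachable C {p} := by
  choose T hT using hne
  choose p hp using fun a ↦ exists_reachable_mem_nhds hU hUC a (T a) (hT a)
  obtain ⟨t, -, ht⟩ := hA.elim_nhds_subcover (fun a ↦ reachable C {p a}) fun a _ ↦ hp a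
  classical
  refine ⟨t.image p, reachable_iUnion_subset C (p := id) ?_⟩
  simpa using ht

/-! ### Timelike cones and relative compactness of J_+(A) ∩ J_-(B). -/

variable {g : LorentzianMetric n M}

theorem LorentzianMetric.continuous_inner (g : LorentzianMetric n M) {X : Type*}
    [TopologicalSpace X] {b : X → M} {v w : (x : X) → TangentSpace (𝓡 n) (b x)}
    (hv : Continuous fun x ↦ (⟨b x, v x⟩ : TangentBundle (𝓡 n) M))
    (hw : Continuous fun x ↦ (⟨b x, w x⟩ : TangentBundle (𝓡 n) M)) :
    Continuous fun x ↦ g.inner (b x) (v x) (w x) := by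
  have hb : Continuous b := (FiberBundle.continuous_proj _ _).comp hv
  have h : Continuous fun m ↦ TotalSpace.mk' ℝ (E := Bundle.Trivial M ℝ) (b m)
      (g.inner (b m) (v m) (w m)) :=
    Continuous.clm_bundle_apply₂ (F₁ := EuclideanSpace ℝ (Fin n))
      (F₂ := EuclideanSpace ℝ (Fin n)) (g.contMDiff.continuous.comp hb) hv hw
  exact (Bundle.Trivial.homeomorphProd M ℝ).continuous.comp h |>.snd

/-- The causal cones have a lightlike boundary; strict inequalities give an open set of vectors
inside them, as the covering argument requires. -/
theorem isOpen_timelike_of_field {X : (x : M) → TangentSpace (𝓡 n) x}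
    (hX : Continuous fun x ↦ (⟨x, X x⟩ : TangentBundle (𝓡 n) M)) :
    IsOpen {v : TangentBundle (𝓡 n) M | g.inner v.1 v.2 v.2 < 0 ∧ g.inner v.1 (X v.1) v.2 < 0} :=
  (isOpen_lt (g.continuous_inner continuous_id continuous_id) continuous_const).inter
    (isOpen_lt (g.continuous_inner (hX.comp (FiberBundle.continuous_proj _ _)) continuous_id)
      continuous_const)

theorem IsCompact.exists_finset_causalFuture (τ : TimeOrientation g) {A : Set M}
    (hA : IsCompact A) : ∃ t : Finset M, causalFuture τ A ⊆ ⋃ p ∈ t, causalFuture τ {p} :=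
  IsCompact.exists_finset_reachable (isOpen_timelike_of_field τ.continuous)
    (fun v hv ↦ ⟨⟨fun h ↦ by simp [h] at hv, hv.1.le⟩, hv.2⟩)
    (fun a ↦ ⟨τ.field a, τ.timelike a, τ.timelike a⟩) hA

theorem IsCompact.exists_finset_causalPast (τ : TimeOrientation g) {A : Set M}
    (hA : IsCompact A) : ∃ t : Finset M, causalPast τ A ⊆ ⋃ p ∈ t, causalPast τ {p} := by
  have hU : IsOpen {v : TangentBundle (𝓡 n) M |
      g.inner v.1 v.2 v.2 < 0 ∧ 0 < g.inner v.1 (τ.field v.1) v.2} :=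
    (isOpen_lt (g.continuous_inner continuous_id continuous_id) continuous_const).inter
      (isOpen_lt continuous_const
        (g.continuous_inner (τ.continuous.comp (FiberBundle.continuous_proj _ _)) continuous_id))
  refine IsCompact.exists_finset_reachable hU
    (fun v hv ↦ ⟨⟨fun h ↦ by simp [h] at hv, hv.1.le⟩, hv.2⟩)
    (fun a ↦ ⟨-τ.field a, ?_, ?_⟩) hA
  · simpa using τ.timelike a
  · simpa using τ.timelike a

/-- In a globally hyperbolic manifold, `J_+(A) ∩ J_-(B)` is relatively compact if `A` and `B` are
compact. -/
theorem GloballyHyperbolic.exists_isCompact {τ : TimeOrientation g} (hM : GloballyHyperbolic τ)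
    {A B : Set M} (hA : IsCompact A) (hB : IsCompact B) :
    ∃ K, IsCompact K ∧ causalFuture τ A ∩ causalPast τ B ⊆ K := by
  obtain ⟨s, hs⟩ := IsCompact.exists_finset_causalFuture τ hA
  obtain ⟨t, ht⟩ := IsCompact.exists_finset_causalPast τ hB
  refine ⟨⋃ p ∈ s, ⋃ q ∈ t, causalFuture τ {p} ∩ causalPast τ {q},
    s.isCompact_biUnion fun p _ ↦ t.isCompact_biUnion fun q _ ↦ hM.isCompact_diamond p q, ?_⟩
  rintro x ⟨hx, hx'⟩
  obtain ⟨p, hp, hxp⟩ := Set.mem_iUnion₂.1 (hs hx)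
  obtain ⟨q, hq, hxq⟩ := Set.mem_iUnion₂.1 (ht hx')
  exact Set.mem_iUnion₂.2 ⟨p, hp, Set.mem_iUnion₂.2 ⟨q, hq, hxp, hxq⟩⟩

end Causality

/-! ### Cutoffs, locality and the adjoint identity. -/

section Cutoff

variable {n : ℕ} {M : Type*} [TopologicalSpace M] [ChartedSpace (EuclideanSpace ℝ (Fin n)) M]
  {𝕜 : Type*} [RCLike 𝕜]
  {F : Type*} [NormedAddCommGroup F] [NormedSpace ℝ F] [NormedSpace 𝕜 F] [IsScalarTower ℝ 𝕜 F]
  {E : M → Type*} [TopologicalSpace (TotalSpace F E)] [∀ x, TopologicalSpace (E x)]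
  [∀ x, AddCommGroup (E x)] [∀ x, Module 𝕜 (E x)] [FiberBundle F E] [VectorBundle 𝕜 F E]

theorem eq_zero_of_notMem_sectionSupport {s : (x : M) → E x} {x : M} (hx : x ∉ sectionSupport s) :
    s x = 0 := by
  by_contra h
  exact hx (subset_closure h)

/-- The product of a smooth real function and a smooth section. -/
noncomputable def mulSection (χ : C^∞⟮𝓡 n, M; 𝓘(ℝ, ℝ), ℝ⟯) (s : smoothSections n 𝕜 F E) :
    smoothSections n 𝕜 F E where
  val x := (χ x : 𝕜) • s.1 x
  property x₀ := by
    have h1 := (contMDiffAt_section x₀).1 (s.2 x₀)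
    rw [contMDiffAt_section]
    refine (χ.contMDiff.contMDiffAt.smul h1).congr_of_eventuallyEq ?_
    filter_upwards [(trivializationAt F E x₀).open_baseSet.mem_nhds
      (mem_baseSet_trivializationAt F E x₀)] with x hx
    refine (((trivializationAt F E x₀).linear 𝕜 hx).map_smul _ _).trans ?_
    exact algebraMap_smul 𝕜 (χ x) _

theorem mulSection_mem_testSections {χ : C^∞⟮𝓡 n, M; 𝓘(ℝ, ℝ), ℝ⟯} {L : Set M} (hL : IsCompact L)
    [T2Space M] (hχ : ∀ x ∉ L, χ x = 0) (s : smoothSections n 𝕜 F E) :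
    mulSection χ s ∈ testSections n 𝕜 F E := by
  refine hL.of_isClosed_subset isClosed_closure (closure_minimal (fun x hx ↦ ?_) hL.isClosed)
  by_contra h
  exact hx (by simp [mulSection, hχ x h])

variable [IsManifold (𝓡 n) ∞ M]

/-- Locality: `s - t` vanishes near `x`, and `P` does not enlarge supports. -/
theorem DiffOp.apply_congr (P : DiffOp n 𝕜 F E) {s t : smoothSections n 𝕜 F E} {x : M}
    (h : ∀ᶠ y in 𝓝 x, s.1 y = t.1 y) : (P.toLinearMap s).1 x = (P.toLinearMap t).1 x := by
  have hx : x ∉ sectionSupport (s - t).1 := by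
    rw [sectionSupport, mem_closure_iff_frequently, Filter.not_frequently]
    filter_upwards [h] with y hy
    simp [hy]
  have := eq_zero_of_notMem_sectionSupport fun hx' ↦ hx (P.sectionSupport_subset _ hx')
  rw [map_sub] at this
  exact sub_eq_zero.1 this

/-- The defining identity of the formal adjoint extends to smooth sections whose supports have
relatively compact intersection. -/
theorem IsFormalAdjoint.integral_eq [T2Space M] [SecondCountableTopology M] [MeasurableSpace M]
    {g : LorentzianMetric n M} {P : DiffOp n 𝕜 F E} {Q : DiffOp n 𝕜 (F →L[𝕜] 𝕜) (Dual 𝕜 E)}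
    (h : IsFormalAdjoint g P Q)
    (u : smoothSections n 𝕜 (F →L[𝕜] 𝕜) (Dual 𝕜 E)) (v : smoothSections n 𝕜 F E) {K : Set M}
    (hK : IsCompact K) (huv : sectionSupport u.1 ∩ sectionSupport v.1 ⊆ K) :
    ∫ x, u.1 x ((P.toLinearMap v).1 x) ∂(volumeMeasure g) =
      ∫ x, (Q.toLinearMap u).1 x (v.1 x) ∂(volumeMeasure g) := by
  have : LocallyCompactSpace M := ChartedSpace.locallyCompactSpace (EuclideanSpace ℝ (Fin n)) M
  obtain ⟨L, hL, hKL⟩ := exists_compact_superset hK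
  obtain ⟨χ, hχ1, hχ0, -⟩ := exists_contMDiffMap_one_nhds_of_subset_interior (𝓡 n) (n := ⊤)
    hK.isClosed hKL
  -- Equality on a neighbourhood, not just at `x`, is what `P` and `Q` need.
  have hχ1' : ∀ x ∈ K, ∀ᶠ y in 𝓝 x, χ y = 1 := fun x hx ↦
    Filter.Eventually.filter_mono (nhds_le_nhdsSet hx) hχ1
  have key := h ⟨_, mulSection_mem_testSections hL hχ0 v⟩ ⟨_, mulSection_mem_testSections hL hχ0 u⟩
  -- Where both supports meet, `χ = 1` nearby. Elsewhere one of the sections vanishes near `x`, and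
  -- both sides are zero.
  have hP : ∀ x, u.1 x ((P.toLinearMap v).1 x) =
      (mulSection χ u).1 x ((P.toLinearMap (mulSection χ v)).1 x) := by
    intro x
    by_cases hxv : x ∈ sectionSupport v.1
    · by_cases hxu : x ∈ sectionSupport u.1
      · have h1 := hχ1' x (huv ⟨hxu, hxv⟩)
        rw [P.apply_congr (s := mulSection χ v) (t := v)
          (by filter_upwards [h1] with y hy; simp [mulSection, hy])]
        simp [mulSection, h1.self_of_nhds]
      · simp [mulSection, eq_zero_of_notMem_sectionSupport hxu]
    · have h0 : ∀ᶠ y in 𝓝 x, v.1 y = 0 := by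
        filter_upwards [isClosed_closure.isOpen_compl.mem_nhds hxv] with y hy
        exact eq_zero_of_notMem_sectionSupport hy
      rw [P.apply_congr (s := mulSection χ v) (t := 0)
          (by filter_upwards [h0] with y hy; simp [mulSection, hy]),
        P.apply_congr (s := v) (t := 0) (by filter_upwards [h0] with y hy; simp [hy])]
      simp
  have hQ : ∀ x, (Q.toLinearMap u).1 x (v.1 x) =
      (Q.toLinearMap (mulSection χ u)).1 x ((mulSection χ v).1 x) := by
    intro x
    by_cases hxu : x ∈ sectionSupport u.1
    · by_cases hxv : x ∈ sectionSupport v.1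
      · have h1 := hχ1' x (huv ⟨hxu, hxv⟩)
        rw [Q.apply_congr (s := mulSection χ u) (t := u)
          (by filter_upwards [h1] with y hy; simp [mulSection, hy])]
        simp [mulSection, h1.self_of_nhds]
      · simp [mulSection, eq_zero_of_notMem_sectionSupport hxv]
    · have h0 : ∀ᶠ y in 𝓝 x, u.1 y = 0 := by
        filter_upwards [isClosed_closure.isOpen_compl.mem_nhds hxu] with y hy
        exact eq_zero_of_notMem_sectionSupport hy
      rw [Q.apply_congr (s := mulSection χ u) (t := 0)
          (by filter_upwards [h0] with y hy; simp [mulSection, hy]),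
        Q.apply_congr (s := u) (t := 0) (by filter_upwards [h0] with y hy; simp [hy])]
      simp
  simp only [hP, hQ]
  exact key

/-- Green's operators for `P` and its formal adjoint with opposite supports are adjoint to each
other. -/
theorem IsGreenOperator.integral_eq [T2Space M] [SecondCountableTopology M] [MeasurableSpace M]
    {g : LorentzianMetric n M} {P : DiffOp n 𝕜 F E} {Q : DiffOp n 𝕜 (F →L[𝕜] 𝕜) (Dual 𝕜 E)}
    (h : IsFormalAdjoint g P Q) {J J' : Set M → Set M}
    (hJ : ∀ A B, IsCompact A → IsCompact B → ∃ K, IsCompact K ∧ J A ∩ J' B ⊆ K)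
    {G' : testSections n 𝕜 (F →L[𝕜] 𝕜) (Dual 𝕜 E) →ₗ[𝕜]
      smoothSections n 𝕜 (F →L[𝕜] 𝕜) (Dual 𝕜 E)} (hG' : IsGreenOperator J Q G')
    {G : testSections n 𝕜 F E →ₗ[𝕜] smoothSections n 𝕜 F E} (hG : IsGreenOperator J' P G)
    (φ : testSections n 𝕜 (F →L[𝕜] 𝕜) (Dual 𝕜 E)) (ψ : testSections n 𝕜 F E) :
    ∫ x, (G' φ).1 x (ψ.1.1 x) ∂(volumeMeasure g) =
      ∫ x, φ.1.1 x ((G ψ).1 x) ∂(volumeMeasure g) := by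
  obtain ⟨K, hK, hsub⟩ := hJ _ _ φ.2 ψ.2
  have := h.integral_eq (G' φ) (G ψ) hK
    ((Set.inter_subset_inter (hG'.support_subset φ) (hG.support_subset ψ)).trans hsub)
  rwa [hG.right_inv, hG'.right_inv] at this

end Cutoff

end LorentzGreen

open LorentzGreen in
theorem mainTheorem5 {n : ℕ}
    {M : Type*} [TopologicalSpace M] [T2Space M] [SecondCountableTopology M]
    [ChartedSpace (EuclideanSpace ℝ (Fin n)) M] [IsManifold (𝓡 n) ∞ M]
    [MeasurableSpace M] [BorelSpace M]
    {g : LorentzianMetric n M} {τ : TimeOrientation g} (hM : GloballyHyperbolic τ)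
    {𝕜 : Type*} [RCLike 𝕜]
    {F : Type*} [NormedAddCommGroup F] [NormedSpace ℝ F] [NormedSpace 𝕜 F] [IsScalarTower ℝ 𝕜 F]
    [FiniteDimensional 𝕜 F]
    {E : M → Type*} [TopologicalSpace (TotalSpace F E)] [∀ x, TopologicalSpace (E x)]
    [∀ x, AddCommGroup (E x)] [∀ x, Module 𝕜 (E x)]
    [∀ x, IsTopologicalAddGroup (E x)] [∀ x, ContinuousSMul 𝕜 (E x)]
    [FiberBundle F E] [VectorBundle 𝕜 F E] [IsSmoothVectorBundle n 𝕜 F E]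
    (P : DiffOp n 𝕜 F E) (hP : IsWaveOperator g P)
    (P' : DiffOp n 𝕜 (F →L[𝕜] 𝕜) (Dual 𝕜 E)) (hP' : IsFormalAdjoint g P P')
    (Gp Gm : testSections n 𝕜 F E →ₗ[𝕜] smoothSections n 𝕜 F E)
    (hGp : IsAdvancedGreenOperator τ P Gp) (hGm : IsRetardedGreenOperator τ P Gm)
    (Gp' Gm' : testSections n 𝕜 (F →L[𝕜] 𝕜) (Dual 𝕜 E) →ₗ[𝕜]
      smoothSections n 𝕜 (F →L[𝕜] 𝕜) (Dual 𝕜 E))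
    (hGp' : IsAdvancedGreenOperator τ P' Gp') (hGm' : IsRetardedGreenOperator τ P' Gm')
    (φ : testSections n 𝕜 (F →L[𝕜] 𝕜) (Dual 𝕜 E)) (ψ : testSections n 𝕜 F E) :
    (∫ x, (Gp' φ).1 x (ψ.1.1 x) ∂(volumeMeasure g) =
      ∫ x, φ.1.1 x ((Gm ψ).1 x) ∂(volumeMeasure g)) ∧
    (∫ x, (Gm' φ).1 x (ψ.1.1 x) ∂(volumeMeasure g) =
      ∫ x, φ.1.1 x ((Gp ψ).1 x) ∂(volumeMeasure g)) := by
  refine ⟨hGp'.integral_eq hP' (fun A B hA hB ↦ hM.exists_isCompact hA hB) hGm φ ψ,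
    hGm'.integral_eq hP' (fun A B hA hB ↦ ?_) hGp φ ψ⟩
  -- The past of `A` now meets the future of `B`, so the two compact sets swap roles.
  obtain ⟨K, hK, h⟩ := hM.exists_isCompact hB hA
  exact ⟨K, hK, Set.inter_comm _ _ ▸ h⟩
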